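/- Let $q,k,\ell\ge 2$ be integers. For a word $x=(x_1,\dots,x_n)$ over $\mathbb Z_q=\{0,\dots,q-1\}$ and $i\in\mathbb Z$, let $R_{i}(x)=\sum_{i-\ell<j\le i,\ 1\le j\le n}\mathsf z_{x_j}$ be the composition (a linear polynomial in formal variables $\mathsf z_0,\dots,\mathsf z_{q-1}$) of the window of length $\ell$ ending at position $i$, and let $\mathcal R_\ell(x)=(R_1(x),\dots,R_{n+\ell-1}(x))$ be the $\ell$-read vector of $x$. A tandem duplication of length $k$ turns a sequence $uvw$ with $|v|=k$ into $uvvw$; let $B_{k,\infty}(y)$ be the set of all sequences obtained from $y$ by finitely many (possibly zero) tandem duplications of length $k$. A code $\mathcal C\subseteq\mathbb Z_q^n$ corrects any number of tandem duplications of length $k$ in $\ell$-read vectors if $B_{k,\infty}(\mathcal R_\ell(x))\cap B_{k,\infty}(\mathcal R_\ell(y))=\emptyset$ for all distinct $x,y\in\mathcal C$; it is optimal if it has the largest cardinality among such codes of length $n$. For a sequence $y=(y_1,\dots,y_m)$ in an abelian group let $\Delta_k(y)=(y_1-y_{1-k},\dots,y_m-y_{m-k})$, with $y_i=0$ for $i\le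 0$, and let $\mu_k(y)$ be obtained from $y$ by replacing each maximal run of zeros, of length $r$ say, by a run of $r \bmod k$ zeros. For each $n$ let $\mathcal C_{k,\ell}(n)\subseteq\mathbb Z_q^n$ be any set that contains exactly one word from each class of the equivalence relation $x\sim y\iff \mu_k(\Delta_k(\mathcal R_\ell(x)))=\mu_k(\Delta_k(\mathcal R_\ell(y)))$ on $\mathbb Z_q^n$. Write $R(S)=\frac1n\log_q|S|$ for the rate of a nonempty $S\subseteq\mathbb Z_q^n$, $n\ge 1$, and let $\lambda_{m,q}$ be the largest real root of $x^{m+2}-qx^{m+1}+q-1$. Theorem. Each $\mathcal C_{k,\ell}(n)$ is an optimal code correcting any number of tandem duplications of length $k$ in $\ell$-read vectors. The limit $\lim_{n\to\infty}R(\mathcal C_{k,\ell}(n))$ exists and $$\lim_{n\to\infty}R(\mathcal C_{k,\ell}(n))\le\log_q\lambda_{k+\ell-2,q}.$$ If additionally $\ell\mid k$, then $$\lim_{n\to\infty}R(\mathcal C_{k,\ell}(n))=\log_q\lambda_{k+\ell-2,q}.$$ Moreover, $\lambda_{k+\ell-2,q}$ is well defined, and $\log_q\lambda_{k+\ell-2,q}$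 is the capacity of $q$-ary $(0,k+\ell-2)$-RLL sequences, i.e. $\lim_{n\to\infty}\frac1n\log_q N_n$, where $N_n$ is the number of words in $\mathbb Z_q^n$ without $k+\ell-1$ consecutive zeros. -/

import Mathlib

open Filter Topology

namespace Nanopore

/-- The composition `c(x)` of a word over `{0, …, q-1}`: the linear polynomial `∑ₐ x|ₐ zₐ`,
represented by its vector of integer coefficients (`x|ₐ` is the number of occurrences of `a`). -/
def composition {q : ℕ} (x : List (Fin q)) : Fin q → ℤ := fun a => (x.count a : ℤ)

/-- The composition `R_{i,ℓ}(x)` of the window `x[i-ℓ+1, i]` of length `ℓ` ending at position `i`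
(positions start at `1`; positions outside the word contribute nothing). -/
def readAt {q : ℕ} (ℓ : ℕ) (x : List (Fin q)) (i : ℕ) : Fin q → ℤ :=
  composition ((x.take i).drop (i - ℓ))

/-- The `ℓ`-read vector `(R_{1,ℓ}(x), …, R_{n+ℓ-1,ℓ}(x))` of a word of length `n`. -/
def readVector {q : ℕ} (ℓ : ℕ) (x : List (Fin q)) : List (Fin q → ℤ) :=
  (List.range (x.length + ℓ - 1)).map fun i => readAt ℓ x (i + 1)

/-- `z` arises from `y` by one tandem duplication of length `k`: `y = u v w` and `z = u v v w`
with `|v| = k`. -/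
def TandemDup {α : Type*} (k : ℕ) (y z : List α) : Prop :=
  ∃ u v w : List α, v.length = k ∧ y = u ++ v ++ w ∧ z = u ++ v ++ v ++ w

/-- The ball `B_{k,∞}(y)`: everything reachable from `y` by finitely many tandem duplications of
length `k`. -/
def ball {α : Type*} (k : ℕ) (y : List α) : Set (List α) :=
  {z | Relation.ReflTransGen (TandemDup k) y z}

/-- The code `C` of length `n` corrects any number of tandem duplications of length `k` in the
`ℓ`-read vectors of its codewords. -/
def Corrects {q n : ℕ} (k ℓ : ℕ) (C : Finset (Fin n → Fin q)) : Prop :=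
  ∀ x ∈ C, ∀ y ∈ C, x ≠ y →
    Disjoint (ball k (readVector ℓ (List.ofFn x))) (ball k (readVector ℓ (List.ofFn y)))

/-- `C` is a largest code of its length among those that correct any number of tandem duplications
of length `k` in the `ℓ`-read vectors. -/
def IsOptimal {q n : ℕ} (k ℓ : ℕ) (C : Finset (Fin n → Fin q)) : Prop :=
  Corrects k ℓ C ∧ ∀ C' : Finset (Fin n → Fin q), Corrects k ℓ C' → C'.card ≤ C.card

/-- The `k`-step derivative `(y₁ - y_{1-k}, …, y_m - y_{m-k})`, where `y_i = 0` for `i ≤ 0`.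
(`List.zipWith` stops at the end of the shorter list, which is `y`.) -/
def derivative {G : Type*} [AddCommGroup G] (k : ℕ) (y : List G) : List G :=
  List.zipWith (fun a b => a - b) y (List.replicate k 0 ++ y)

/-- Auxiliary recursion for `mu`; the first argument after `k` is the number of zeros read so far
in the current run of zeros. -/
def muAux {G : Type*} [AddCommGroup G] [DecidableEq G] (k : ℕ) : ℕ → List G → List G
  | m, [] => List.replicate (m % k) 0
  | m, a :: y =>
      if a = 0 then muAux k (m + 1) y
      else List.replicate (m % k) 0 ++ a :: muAux k 0 y

/-- `μ_k`: every maximal run of zeros, of length `m` say, is replaced by a run of `m mod k`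
zeros. -/
def mu {G : Type*} [AddCommGroup G] [DecidableEq G] (k : ℕ) (y : List G) : List G :=
  muAux k 0 y

/-- The nucleus `μ_k(Δ_k(R_ℓ(x)))` of a word. -/
def nucleus {q n : ℕ} (k ℓ : ℕ) (x : Fin n → Fin q) : List (Fin q → ℤ) :=
  mu k (derivative k (readVector ℓ (List.ofFn x)))

/-- `C` is a code `C_{k,ℓ}(n)`: it contains exactly one word from each class of the equivalence
relation "same nucleus" on words of length `n`. -/
def IsNucleusCode {q n : ℕ} (k ℓ : ℕ) (C : Finset (Fin n → Fin q)) : Prop :=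
  ∀ x : Fin n → Fin q, ∃! c : Fin n → Fin q, c ∈ C ∧ nucleus k ℓ c = nucleus k ℓ x

/-- The rate `(1/n) log_q |S|` of a set of words of length `n` over an alphabet of size `q`. -/
noncomputable def rate {q n : ℕ} (S : Finset (Fin n → Fin q)) : ℝ :=
  1 / (n : ℝ) * Real.logb q S.card

/-- The `q`-ary `(0,m)`-RLL words of length `n`: those with no `m + 1` consecutive zeros. -/
def rll (q m n : ℕ) : Finset (Fin n → Fin q) :=
  Finset.univ.filter fun x =>
    ¬ List.replicate (m + 1) 0 <:+: List.ofFn (fun i => (x i : ℕ))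

/-- The real roots of `x^{m+2} - q x^{m+1} + q - 1`. -/
def rllRoots (m q : ℕ) : Set ℝ :=
  {x : ℝ | x ^ (m + 2) - (q : ℝ) * x ^ (m + 1) + (q : ℝ) - 1 = 0}

/-- `λ_{m,q}`, the largest real root of `x^{m+2} - q x^{m+1} + q - 1`. -/
noncomputable def rllLambda (m q : ℕ) : ℝ := sSup (rllRoots m q)

end Nanopore

namespace Nanopore

/-! ### Removing runs of zeros -/

section Mu

variable {G : Type*} [AddCommGroup G] [DecidableEq G]

/-! The derivative turns a tandem duplication of length k into an insertion of k zeros: the copied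
block minus itself vanishes, and later entries keep their partners. Inserting k zeros is confluent
(`join_of_reachable`) with normal form `mu k`, so different nuclei have disjoint balls. Conversely,
all entries of a read vector are nonzero, so zeros of its derivative occur only after the first k
entries, where insertions lift back to duplications. Hence equal nuclei give intersecting balls
(`not_disjoint_ball`). A code therefore corrects exactly when the nucleus is injective on it, and
the optimal size is the number M(n) of nuclei (`numNuclei`).

Limit: the nucleus of a concatenation depends only on the two nuclei and boundedly many letters at
the joint, so M(n+m) ≤ K M(n) M(m), and Fekete's lemma applies.

Upper bound: if a word repeats with distance k at k+ℓ-1 consecutive positions, then k consecutive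
derivative entries vanish, and deleting k letters keeps the nucleus. Words without such repetition
are counted by RLL words, so M(n+k) ≤ M(n) + q^k N_n. A transfer-matrix eigenvector shows that N_n
has order λ^n, and the recursion gives M(n) = O(λ^n).

Lower bound for ℓ ∣ k: now k vanishing derivative entries conversely force k+ℓ-1 repetitions
(`unitSeq_sub_eq_zero_of_windowDiff`). For words whose step derivative is RLL, `mu` then removes
nothing and the nucleus determines the word, so N_n ≤ M(n). -/

lemma muAux_add_self (k m : ℕ) (y : List G) : muAux k (m + k) y = muAux k m y := by
  induction y generalizing m with
  | nil => simp [muAux]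
  | cons a y ih =>
    rw [muAux, muAux, show m + k + 1 = m + 1 + k by omega, ih]
    simp

lemma muAux_replicate_append (k m r : ℕ) (y : List G) :
    muAux k m (List.replicate r 0 ++ y) = muAux k (m + r) y := by
  induction r generalizing m with
  | zero => simp
  | succ r ih =>
    rw [List.replicate_succ, List.cons_append, muAux, if_pos rfl, ih]
    congr 1; omega

lemma muAux_append_replicate_append (k m : ℕ) (a b : List G) :
    muAux k m (a ++ (List.replicate k 0 ++ b)) = muAux k m (a ++ b) := by
  induction a generalizing m with
  | nil => simp [muAux_replicate_append, muAux_add_self]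
  | cons c a ih => simp only [List.cons_append, muAux, ih]

/-- `z` arises from `y` by inserting a block of `k` zeros. -/
def InsertZeros {G : Type*} [AddCommGroup G] (k : ℕ) (y z : List G) : Prop :=
  ∃ a b : List G, y = a ++ b ∧ z = a ++ (List.replicate k 0 ++ b)

lemma InsertZeros.mu_eq {k : ℕ} {y z : List G} (h : InsertZeros k y z) : mu k y = mu k z := by
  obtain ⟨a, b, rfl, rfl⟩ := h
  exact (muAux_append_replicate_append k 0 a b).symm

end Mu

lemma InsertZeros.append {G : Type*} [AddCommGroup G] {k : ℕ} {y z : List G}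
    (h : InsertZeros k y z) (c d : List G) :
    InsertZeros k (c ++ (y ++ d)) (c ++ (z ++ d)) := by
  obtain ⟨a, b, rfl, rfl⟩ := h
  exact ⟨c ++ a, b ++ d, by simp, by simp⟩

lemma reachable_append {G : Type*} [AddCommGroup G] {k : ℕ} {y z : List G}
    (h : Relation.ReflTransGen (InsertZeros k) y z) (c d : List G) :
    Relation.ReflTransGen (InsertZeros k) (c ++ (y ++ d)) (c ++ (z ++ d)) :=
  h.lift (fun l => c ++ (l ++ d)) fun _ _ h => h.append c d

lemma reachable_replicate {G : Type*} [AddCommGroup G] (k m r : ℕ) :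
    Relation.ReflTransGen (InsertZeros k)
      (List.replicate m (0 : G)) (List.replicate (m + k * r) 0) := by
  induction r with
  | zero => exact .refl
  | succ r ih =>
    refine ih.tail ⟨[], List.replicate (m + k * r) 0, rfl, ?_⟩
    rw [List.nil_append, ← List.replicate_add]
    congr 1; ring

/-- Inserting blocks of `k` zeros is confluent. -/
lemma join_of_reachable {G : Type*} [AddCommGroup G] {k : ℕ} {a b c : List G}
    (hab : Relation.ReflTransGen (InsertZeros k) a b)
    (hac : Relation.ReflTransGen (InsertZeros k) a c) :
    ∃ d, Relation.ReflTransGen (InsertZeros k) b d ∧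
      Relation.ReflTransGen (InsertZeros k) c d := by
  refine Relation.church_rosser ?_ hab hac
  rintro _ _ _ ⟨a, b, rfl, rfl⟩ ⟨a', b', h, rfl⟩
  rcases List.append_eq_append_iff.1 h with ⟨c, rfl, rfl⟩ | ⟨c, rfl, rfl⟩
  · exact ⟨a ++ (List.replicate k 0 ++ (c ++ (List.replicate k 0 ++ b'))),
      .single ⟨a ++ (List.replicate k 0 ++ c), b', by simp, by simp⟩,
      .single ⟨a, c ++ (List.replicate k 0 ++ b'), by simp, by simp⟩⟩
  · exact ⟨a' ++ (List.replicate k 0 ++ (c ++ (List.replicate k 0 ++ b))),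
      .single ⟨a', c ++ (List.replicate k 0 ++ b), by simp, by simp⟩,
      .single ⟨a' ++ (List.replicate k 0 ++ c), b, by simp, by simp⟩⟩

section Mu

variable {G : Type*} [AddCommGroup G] [DecidableEq G]

lemma mu_eq_of_reachable {k : ℕ} {y z : List G}
    (h : Relation.ReflTransGen (InsertZeros k) y z) : mu k y = mu k z := by
  induction h with
  | refl => rfl
  | tail _ h ih => exact ih.trans h.mu_eq

/-- The counter m stands for m zeros already read but not yet written, hence the prefix on the
right. -/
lemma reachable_muAux (k m : ℕ) (y : List G) :
    Relation.ReflTransGen (InsertZeros k) (muAux k m y) (List.replicate m 0 ++ y) := by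
  have hr : ∀ m : ℕ, Relation.ReflTransGen (InsertZeros k)
      (List.replicate (m % k) (0 : G)) (List.replicate m 0) := fun m => by
    simpa only [Nat.mod_add_div] using reachable_replicate (G := G) k (m % k) (m / k)
  induction y generalizing m with
  | nil => simpa [muAux] using hr m
  | cons a y ih =>
    rw [muAux]
    split_ifs with h
    · subst h
      simpa [List.replicate_succ'] using ih (m + 1)
    · have h1 := reachable_append (hr m) [] (a :: muAux k 0 y)
      have h2 := reachable_append (ih 0) (List.replicate m 0 ++ [a]) []
      simp only [List.nil_append, List.append_nil, List.append_assoc, List.replicate_zero,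
        List.singleton_append] at h1 h2
      exact h1.trans h2

lemma reachable_mu (k : ℕ) (y : List G) :
    Relation.ReflTransGen (InsertZeros k) (mu k y) y := by
  have := reachable_muAux k 0 y
  rwa [List.replicate_zero, List.nil_append] at this

lemma mu_append_congr {k : ℕ} {y z : List G} (h : mu k y = mu k z) (c d : List G) :
    mu k (c ++ (y ++ d)) = mu k (c ++ (z ++ d)) := by
  rw [← mu_eq_of_reachable (reachable_append (reachable_mu k y) c d),
    ← mu_eq_of_reachable (reachable_append (reachable_mu k z) c d), h]

lemma mu_append_congr₂ {k : ℕ} {a a' b b' : List G} (h : mu k a = mu k a')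
    (h' : mu k b = mu k b') : mu k (a ++ b) = mu k (a' ++ b') := by
  have h1 := mu_append_congr h [] b
  have h2 := mu_append_congr h' a' []
  simp only [List.nil_append, List.append_nil] at h1 h2
  exact h1.trans h2

lemma muAux_append_cons (k m : ℕ) (y z : List G) {a : G} (ha : a ≠ 0) :
    muAux k m (y ++ a :: z) = muAux k m y ++ a :: muAux k 0 z := by
  induction y generalizing m with
  | nil => simp [muAux, ha]
  | cons b y ih =>
    simp only [List.cons_append, muAux, ih]
    split_ifs <;> simp

lemma mu_append_cons (k : ℕ) (y z : List G) {a : G} (ha : a ≠ 0) :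
    mu k (y ++ a :: z) = mu k y ++ a :: mu k z :=
  muAux_append_cons k 0 y z ha

lemma mu_append_of_ne_zero (k : ℕ) {p : List G} (hp : ∀ a ∈ p, a ≠ 0) (y : List G) :
    mu k (p ++ y) = p ++ mu k y := by
  induction p with
  | nil => rfl
  | cons a p ih =>
    have h := mu_append_cons k [] (p ++ y) (hp a (by simp))
    simp only [List.nil_append] at h
    rw [List.cons_append, h, ih fun b hb => hp b (by simp [hb])]
    simp [mu, muAux]

lemma mu_append_replicate_append (k : ℕ) (a b : List G) :
    mu k (a ++ (List.replicate k 0 ++ b)) = mu k (a ++ b) :=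
  muAux_append_replicate_append k 0 a b

/-- Modulo `mu k`, lists form the monoid with the single relation 0^k = 1. Zero is invertible there
with inverse 0^(k-1), and the nonzero letters are free, so the monoid is cancellative. -/
lemma mu_append_left_cancel {k : ℕ} (hk : 0 < k) (p : List G) {y z : List G}
    (h : mu k (p ++ y) = mu k (p ++ z)) : mu k y = mu k z := by
  induction p with
  | nil => exact h
  | cons a p ih =>
    apply ih
    by_cases ha : a = 0
    · have key : ∀ w : List G, mu k (List.replicate (k - 1) 0 ++ (a :: w)) = mu k w := fun w => by
        have := mu_append_replicate_append k [] w
        rw [List.nil_append, List.nil_append] at this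
        rw [← this, ha]
        obtain ⟨k, rfl⟩ : ∃ j, k = j + 1 := ⟨k - 1, by omega⟩
        simp [List.replicate_succ']
      rw [← key (p ++ y), ← key (p ++ z)]
      exact mu_append_congr₂ rfl h
    · have key := fun w => mu_append_cons k [] w ha
      simp only [List.nil_append] at key
      rw [List.cons_append, List.cons_append, key, key] at h
      simpa using h

lemma mu_append_right_cancel {k : ℕ} (hk : 0 < k) (p : List G) {y z : List G}
    (h : mu k (y ++ p) = mu k (z ++ p)) : mu k y = mu k z := by
  induction p generalizing y z with
  | nil => simpa using h
  | cons a p ih =>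
    have h1 : mu k (y ++ [a]) = mu k (z ++ [a]) := ih (by simpa using h)
    by_cases ha : a = 0
    · have key : ∀ w : List G, mu k ((w ++ [a]) ++ List.replicate (k - 1) 0) = mu k w := fun w => by
        have := mu_append_replicate_append k w []
        rw [List.append_nil, List.append_nil] at this
        rw [← this, ha]
        obtain ⟨k, rfl⟩ : ∃ j, k = j + 1 := ⟨k - 1, by omega⟩
        simp [List.replicate_succ]
      rw [← key y, ← key z]
      exact mu_append_congr₂ h1 rfl
    · rw [mu_append_cons k y [] ha, mu_append_cons k z [] ha] at h1
      simpa using h1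

lemma muAux_eq_of_not_infix {k m : ℕ} {y : List G}
    (h : ¬ List.replicate k 0 <:+: List.replicate m 0 ++ y) :
    muAux k m y = List.replicate m 0 ++ y := by
  have hm : ∀ z : List G, ¬ List.replicate k 0 <:+: List.replicate m 0 ++ z → m % k = m :=
    fun z hz => Nat.mod_eq_of_lt <| by
      by_contra! hkm
      refine hz ⟨[], List.replicate (m - k) 0 ++ z, ?_⟩
      rw [List.nil_append, ← List.append_assoc, ← List.replicate_add, Nat.add_sub_cancel' hkm]
  induction y generalizing m with
  | nil => simp [muAux, hm _ h]
  | cons a y ih =>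
    rw [muAux]
    split_ifs with ha
    · subst ha
      have e : List.replicate m 0 ++ 0 :: y = List.replicate (m + 1) (0 : G) ++ y := by
        simp [List.replicate_succ']
      rw [e] at h ⊢
      refine ih h fun z hz => Nat.mod_eq_of_lt ?_
      by_contra! hkm
      refine hz ⟨[], List.replicate (m + 1 - k) 0 ++ z, ?_⟩
      rw [List.nil_append, ← List.append_assoc, ← List.replicate_add, Nat.add_sub_cancel' hkm]
    · rw [hm _ h, ih (m := 0)]
      · simp
      · intro h'
        exact h (h'.trans ⟨List.replicate m 0 ++ [a], [], by simp⟩)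
      · intro z hz
        exact Nat.zero_mod k

lemma mu_eq_of_not_infix {k : ℕ} {y : List G} (h : ¬ List.replicate k 0 <:+: y) :
    mu k y = y := by
  have := muAux_eq_of_not_infix (k := k) (m := 0) (y := y) (by simpa using h)
  rwa [List.replicate_zero, List.nil_append] at this

end Mu

/-! ### The derivative -/

section Derivative

variable {G : Type*} [AddCommGroup G]

lemma length_derivative (k : ℕ) (y : List G) : (derivative k y).length = y.length := by
  simp [derivative]

lemma getElem_derivative (k : ℕ) (y : List G) (i : ℕ) (h : i < (derivative k y).length) :
    (derivative k y)[i] = y[i]'(by simpa [length_derivative] using h) -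
      if h' : i < k then 0 else y[i - k]'(by rw [length_derivative] at h; omega) := by
  simp only [derivative, List.getElem_zipWith, List.getElem_append, List.length_replicate,
    List.getElem_replicate]

lemma derivative_append (k : ℕ) (u v w : List G) (hv : v.length = k) :
    derivative k (u ++ v ++ w) =
      List.zipWith (fun a b => a - b) (u ++ v) (List.replicate k 0 ++ u) ++
        List.zipWith (fun a b => a - b) w (v ++ w) := by
  rw [← List.zipWith_append (by simp [hv, add_comm])]
  simp [derivative]

lemma derivative_duplicate (k : ℕ) (u v w : List G) (hv : v.length = k) :
    derivative k (u ++ v ++ v ++ w) =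
      List.zipWith (fun a b => a - b) (u ++ v) (List.replicate k 0 ++ u) ++
        (List.replicate k 0 ++ List.zipWith (fun a b => a - b) w (v ++ w)) := by
  have h : List.zipWith (fun a b => a - b) v v = List.replicate k (0 : G) := by
    rw [List.zipWith_self]; simp [hv]
  have e : derivative k (u ++ v ++ v ++ w) =
      List.zipWith (fun a b => a - b) (u ++ v) (List.replicate k 0 ++ u) ++
        (List.zipWith (fun a b => a - b) v v ++
          List.zipWith (fun a b => a - b) w (v ++ w)) := by
    rw [← List.zipWith_append rfl, ← List.zipWith_append (by simp [hv, add_comm])]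
    simp only [derivative, List.append_assoc]
  rw [e, h]

lemma TandemDup.insertZeros {k : ℕ} {y z : List G} (h : TandemDup k y z) :
    InsertZeros k (derivative k y) (derivative k z) := by
  obtain ⟨u, v, w, hv, rfl, rfl⟩ := h
  exact ⟨_, _, derivative_append k u v w hv, derivative_duplicate k u v w hv⟩

lemma derivative_injective {k : ℕ} (hk : 0 < k) :
    Function.Injective (derivative k : List G → List G) := by
  intro y z h
  have hl : y.length = z.length := by
    rw [← length_derivative k y, h, length_derivative]
  refine List.ext_getElem hl fun i => ?_
  induction i using Nat.strong_induction_on with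
  | _ i ih =>
    intro h1 h2
    have e := List.getElem_of_eq h (i := i) (by rwa [length_derivative])
    rw [getElem_derivative, getElem_derivative] at e
    split_ifs at e with hi
    · simpa using e
    · rw [ih (i - k) (by omega) (by omega) (by omega)] at e
      simpa using e

lemma take_derivative (k : ℕ) (y : List G) : (derivative k y).take k = y.take k := by
  apply List.ext_getElem
  · simp [length_derivative]
  · intro i h1 h2
    simp only [List.length_take] at h2
    rw [List.getElem_take, List.getElem_take, getElem_derivative, dif_pos (by omega), sub_zero]

/-- Insertions of zeros into the derivative after its first `k` entries lift to tandem
duplications. -/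
lemma exists_tandemDup_of_reachable {k : ℕ} {y p t t' : List G} (hp : p.length = k)
    (hy : derivative k y = p ++ t) (h : Relation.ReflTransGen (InsertZeros k) t t') :
    ∃ z ∈ ball k y, derivative k z = p ++ t' := by
  induction h with
  | refl => exact ⟨y, .refl, hy⟩
  | tail _ h ih =>
    obtain ⟨z, hz, hzd⟩ := ih
    obtain ⟨a, b, rfl, rfl⟩ := h
    have hl := length_derivative k z
    rw [hzd] at hl
    simp only [List.length_append] at hl
    -- An insertion after `a` in the tail happens at position k + |a| of the derivative, so the
    -- block to be copied is the one of length k ending there.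
    obtain ⟨u, v, w, hu, hv, rfl⟩ : ∃ u v w : List G, u.length = a.length ∧ v.length = k ∧
        z = u ++ v ++ w := by
      refine ⟨z.take a.length, (z.drop a.length).take k, (z.drop a.length).drop k, ?_, ?_, ?_⟩
      · simp; omega
      · simp; omega
      · simp [List.append_assoc, List.take_append_drop]
    refine ⟨u ++ v ++ v ++ w, hz.tail ⟨u, v, w, hv, rfl, rfl⟩, ?_⟩
    rw [derivative_append k u v w hv, ← List.append_assoc] at hzd
    obtain ⟨h1, h2⟩ := List.append_inj hzd (by simp [hu, hv, hp]; omega)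
    rw [derivative_duplicate k u v w hv, h1, h2]
    simp

lemma mu_derivative_eq_of_mem_ball [DecidableEq G] {k : ℕ} {y z : List G} (h : z ∈ ball k y) :
    mu k (derivative k y) = mu k (derivative k z) :=
  mu_eq_of_reachable (Relation.ReflTransGen.lift (derivative k) (fun _ _ h => TandemDup.insertZeros h) y z h)

/-- Sequences of nonzero elements with the same nucleus have a common descendant. -/
lemma not_disjoint_ball [DecidableEq G] {k : ℕ} (hk : 0 < k) {y z : List G}
    (hl : y.length = z.length) (hy : ∀ a ∈ y, a ≠ 0) (hz : ∀ a ∈ z, a ≠ 0)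
    (h : mu k (derivative k y) = mu k (derivative k z)) :
    ¬ Disjoint (ball k y) (ball k z) := by
  rw [Set.not_disjoint_iff]
  have split : ∀ y : List G,
      derivative k y = y.take k ++ (derivative k y).drop k := fun y => by
    rw [← take_derivative, List.take_append_drop]
  have ht : ∀ y : List G, (∀ a ∈ y, a ≠ 0) → ∀ a ∈ y.take k, a ≠ 0 :=
    fun y hy a ha => hy a (List.mem_of_mem_take ha)
  have h0 := h
  rw [split y, split z, mu_append_of_ne_zero k (ht y hy), mu_append_of_ne_zero k (ht z hz)] at h
  obtain ⟨h1, h2⟩ := List.append_inj h (by simp [hl])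
  rcases le_or_gt k y.length with hky | hky
  · have j1 := reachable_mu k ((derivative k y).drop k)
    have j2 := reachable_mu k ((derivative k z).drop k)
    rw [← h2] at j2
    obtain ⟨d, hd1, hd2⟩ := join_of_reachable j1 j2
    obtain ⟨c, hc, hcd⟩ := exists_tandemDup_of_reachable (by simpa using hky) (split y) hd1
    obtain ⟨c', hc', hcd'⟩ := exists_tandemDup_of_reachable (by simpa [← hl] using hky) (split z) hd2
    have : c = c' := derivative_injective hk (by rw [hcd, hcd', h1])
    exact ⟨c, hc, this ▸ hc'⟩
  -- A sequence shorter than k is its own derivative, so equal nuclei already mean equal sequences.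
  · rw [List.take_of_length_le hky.le, List.take_of_length_le (hl ▸ hky.le)] at h1
    subst h1
    exact ⟨y, .refl, .refl⟩

end Derivative

/-! ### Words as integer-indexed sequences -/

/-- The sequence of unit vectors of a word, extended by zero to all integer positions
(the letters have positions `0, …, n - 1`). -/
def unitSeq {q n : ℕ} (x : Fin n → Fin q) (i : ℤ) : Fin q → ℤ :=
  if h : 0 ≤ i ∧ i < n then Pi.single (x ⟨i.toNat, by omega⟩) 1 else 0

/-- The sum of `X` over the window of length `ℓ` ending at `i`. -/
def windowSum {G : Type*} [AddCommGroup G] (ℓ : ℕ) (X : ℤ → G) (i : ℤ) : G :=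
  ∑ j ∈ Finset.range ℓ, X (i - j)

/-- The difference of two windows of length `ℓ` at distance `k`. -/
def windowDiff {G : Type*} [AddCommGroup G] (k ℓ : ℕ) (X : ℤ → G) (i : ℤ) : G :=
  windowSum ℓ X i - windowSum ℓ X (i - k)

lemma unitSeq_natCast {q n : ℕ} (x : Fin n → Fin q) (i : Fin n) :
    unitSeq x (i : ℕ) = Pi.single (x i) 1 := by
  simp [unitSeq]

lemma unitSeq_of_lt {q n : ℕ} (x : Fin n → Fin q) {i : ℤ} (h : 0 ≤ i) (h' : i < n) :
    unitSeq x i = Pi.single (x ⟨i.toNat, by omega⟩) 1 :=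
  dif_pos ⟨h, h'⟩

lemma unitSeq_of_neg {q n : ℕ} (x : Fin n → Fin q) {i : ℤ} (h : i < 0) : unitSeq x i = 0 :=
  dif_neg (by omega)

lemma unitSeq_of_le {q n : ℕ} (x : Fin n → Fin q) {i : ℤ} (h : n ≤ i) : unitSeq x i = 0 :=
  dif_neg (by omega)

lemma unitSeq_nonneg {q n : ℕ} (x : Fin n → Fin q) (i : ℤ) (a : Fin q) : 0 ≤ unitSeq x i a := by
  unfold unitSeq
  split_ifs
  · by_cases h : a = x ⟨i.toNat, by omega⟩
    · subst h; simp
    · simp [h]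
  · simp

lemma single_one_injective {ι : Type*} [DecidableEq ι] :
    Function.Injective fun a : ι => (Pi.single a 1 : ι → ℤ) := by
  intro a b h
  by_contra hab
  have := congrFun h a
  simp [hab] at this

lemma windowSum_of_neg {q n : ℕ} (ℓ : ℕ) (x : Fin n → Fin q) {i : ℤ} (h : i < 0) :
    windowSum ℓ (unitSeq x) i = 0 :=
  Finset.sum_eq_zero fun j _ => unitSeq_of_neg x (by omega)

/-- Reads are numbered from 1, entries of `unitSeq` from 0. Induction on ℓ extends the window by one
letter on the left. -/
lemma readAt_succ_eq {q n : ℕ} (ℓ : ℕ) (x : Fin n → Fin q) (i : ℕ) :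
    readAt ℓ (List.ofFn x) (i + 1) = windowSum ℓ (unitSeq x) i := by
  induction ℓ with
  | zero =>
    funext a
    simp [readAt, windowSum, composition]
  | succ ℓ ih =>
    rw [windowSum, Finset.sum_range_succ, ← windowSum, ← ih]
    rcases le_or_gt (i + 1) ℓ with h | h
    · rw [unitSeq_of_neg x (by omega), add_zero, readAt, readAt,
        Nat.sub_eq_zero_of_le h, Nat.sub_eq_zero_of_le (by omega)]
    · rw [readAt, readAt, show i + 1 - ℓ = i + 1 - (ℓ + 1) + 1 by omega]
      set p := i + 1 - (ℓ + 1) with hp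
      have hpi : (i : ℤ) - ℓ = (p : ℕ) := by omega
      rw [hpi]
      rcases lt_or_ge p n with hpn | hpn
      · rw [List.drop_eq_getElem_cons (by simp; omega), List.getElem_take, List.getElem_ofFn,
          unitSeq_natCast x ⟨p, hpn⟩]
        funext a
        by_cases ha : a = x ⟨p, hpn⟩
        · subst ha; simp [composition]
        · simp [composition, ha, Ne.symm ha]
      · rw [unitSeq_of_le x (by exact_mod_cast hpn), List.drop_eq_nil_of_le (by simp; omega),
          List.drop_eq_nil_of_le (by simp; omega), add_zero]

lemma readVector_eq {q n : ℕ} (ℓ : ℕ) (x : Fin n → Fin q) :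
    readVector ℓ (List.ofFn x) =
      (List.range (n + ℓ - 1)).map fun i : ℕ => windowSum ℓ (unitSeq x) i := by
  simp [readVector, readAt_succ_eq]

lemma derivative_readVector {q n : ℕ} (k ℓ : ℕ) (x : Fin n → Fin q) :
    derivative k (readVector ℓ (List.ofFn x)) =
      (List.range (n + ℓ - 1)).map fun i : ℕ => windowDiff k ℓ (unitSeq x) i := by
  rw [readVector_eq]
  apply List.ext_getElem
  · simp [length_derivative]
  · intro i h1 h2
    rw [getElem_derivative]
    simp only [List.getElem_map, List.getElem_range, windowDiff]
    split_ifs with h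
    · rw [windowSum_of_neg ℓ x (i := (i : ℤ) - k) (by omega)]
    · rw [Nat.cast_sub (by omega)]

lemma nucleus_eq {q n : ℕ} (k ℓ : ℕ) (x : Fin n → Fin q) :
    nucleus k ℓ x =
      mu k ((List.range (n + ℓ - 1)).map fun i : ℕ => windowDiff k ℓ (unitSeq x) i) := by
  rw [nucleus, derivative_readVector]

lemma windowSum_ne_zero {q n ℓ : ℕ} (x : Fin n → Fin q) (hn : 0 < n) (hℓ : 0 < ℓ) {i : ℤ}
    (h0 : 0 ≤ i) (hi : i < n + ℓ - 1) : windowSum ℓ (unitSeq x) i ≠ 0 := by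
  intro h
  -- This makes i - j = min(i, n - 1), a position of the word inside the window. Its letter
  -- contributes positively, and nothing can cancel it.
  set j := (i - (n - 1)).toNat with hj
  have h1 : 0 ≤ i - j := by omega
  have h2 : i - j < n := by omega
  have h3 := congrFun h (x ⟨(i - j).toNat, by omega⟩)
  rw [windowSum, Finset.sum_apply, Pi.zero_apply,
    Finset.sum_eq_zero_iff_of_nonneg fun _ _ => unitSeq_nonneg x _ _] at h3
  have h4 := h3 j (by simp; omega)
  rw [unitSeq_of_lt x h1 h2] at h4
  simp at h4

/-! ### Codes with one word per nucleus are optimal -/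

lemma readVector_ne_zero {q n ℓ : ℕ} (x : Fin n → Fin q) (hn : 0 < n) (hℓ : 0 < ℓ) :
    ∀ a ∈ readVector ℓ (List.ofFn x), a ≠ 0 := by
  rw [readVector_eq]
  simp only [List.mem_map, List.mem_range]
  rintro _ ⟨i, hi, rfl⟩
  exact windowSum_ne_zero x hn hℓ (by omega) (by omega)

lemma IsNucleusCode.card_eq {q n k ℓ : ℕ} {C : Finset (Fin n → Fin q)}
    (hC : IsNucleusCode k ℓ C) :
    C.card = (Finset.univ.image (nucleus k ℓ : (Fin n → Fin q) → List (Fin q → ℤ))).card := by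
  have hinj : Set.InjOn (nucleus k ℓ : (Fin n → Fin q) → List (Fin q → ℤ)) C :=
    fun x hx y hy h => (hC y).unique ⟨hx, h⟩ ⟨hy, rfl⟩
  rw [← Finset.card_image_of_injOn hinj]
  congr 1
  ext d
  simp only [Finset.mem_image, Finset.mem_univ, true_and]
  constructor
  · rintro ⟨x, -, hx⟩
    exact ⟨x, hx⟩
  · rintro ⟨x, rfl⟩
    obtain ⟨c, ⟨hc, hcx⟩, -⟩ := hC x
    exact ⟨c, hc, hcx⟩

lemma IsNucleusCode.isOptimal {q n k ℓ : ℕ} (hk : 0 < k) (hℓ : 0 < ℓ)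
    {C : Finset (Fin n → Fin q)} (hC : IsNucleusCode k ℓ C) : IsOptimal k ℓ C := by
  constructor
  · intro x hx y hy hxy
    rw [Set.disjoint_left]
    intro z hz hz'
    exact hxy ((hC y).unique ⟨hx, (mu_derivative_eq_of_mem_ball hz).trans
      (mu_derivative_eq_of_mem_ball hz').symm⟩ ⟨hy, rfl⟩)
  · intro C' hC'
    rw [hC.card_eq]
    refine Finset.card_le_card_of_injOn (nucleus k ℓ) (fun x _ => by simp) ?_
    intro x hx y hy h
    by_contra hxy
    have hn : 0 < n := by
      rcases Nat.eq_zero_or_pos n with rfl | hn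
      · exact absurd (Subsingleton.elim x y) hxy
      · exact hn
    exact not_disjoint_ball hk (by simp [readVector]) (readVector_ne_zero x hn hℓ)
      (readVector_ne_zero y hn hℓ) h (hC' x hx y hy hxy)

/-! ### The largest root of the characteristic polynomial -/

lemma isGreatest_rllLambda (m : ℕ) {q : ℕ} (hq : 2 ≤ q) :
    IsGreatest (rllRoots m q) (rllLambda m q) := by
  have hq' : (2 : ℝ) ≤ q := by exact_mod_cast hq
  have hne : (rllRoots m q).Nonempty := ⟨1, by simp [rllRoots]⟩
  -- Beyond q the polynomial is x^(m+1) (x - q) + (q - 1) > 0.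
  have hb : BddAbove (rllRoots m q) := by
    refine ⟨q, fun x hx => ?_⟩
    by_contra! h
    have h1 : 0 < x ^ (m + 1) := by
      have : 0 < x := by linarith
      positivity
    have h2 : 0 < x ^ (m + 1) * (x - q) := mul_pos h1 (by linarith)
    have hx' : x ^ (m + 2) - (q : ℝ) * x ^ (m + 1) + (q : ℝ) - 1 = 0 := hx
    have h3 : x ^ (m + 2) = x ^ (m + 1) * x := pow_succ _ _
    linarith
  have hc : IsClosed (rllRoots m q) :=
    isClosed_eq (by fun_prop) continuous_const
  exact ⟨hc.csSup_mem hne hb, fun x hx => le_csSup hb hx⟩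

/-- The polynomial is (x - 1) g(x). Here g(1) = 1 - (q - 1)(m + 1) is negative because m ≥ 1, while
g(q) = 1, so g has a root above the trivial root 1. -/
lemma one_lt_rllLambda {m q : ℕ} (hm : 1 ≤ m) (hq : 2 ≤ q) : 1 < rllLambda m q := by
  have hq' : (2 : ℝ) ≤ q := by exact_mod_cast hq
  have hm' : (1 : ℝ) ≤ m := by exact_mod_cast hm
  let g : ℝ → ℝ := fun x => x ^ (m + 1) - (q - 1) * ∑ i ∈ Finset.range (m + 1), x ^ i
  have hg : Continuous g := by fun_prop
  have hg1 : g 1 < 0 := by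
    simp only [g, one_pow, Finset.sum_const, Finset.card_range, nsmul_eq_mul, mul_one]
    push_cast
    nlinarith
  have hgeom := fun x : ℝ => geom_sum_mul x (m + 1)
  have hgq : 0 < g q := by
    have := hgeom q
    simp only [g]
    linarith
  obtain ⟨x, hx, hx0⟩ := intermediate_value_Icc (show (1 : ℝ) ≤ q by linarith) hg.continuousOn
    (show (0 : ℝ) ∈ Set.Icc (g 1) (g q) from ⟨hg1.le, hgq.le⟩)
  have hx1 : 1 < x := lt_of_le_of_ne hx.1 fun h => by rw [← h] at hx0; linarith
  refine hx1.trans_le ((isGreatest_rllLambda m hq).2 ?_)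
  show x ^ (m + 2) - (q : ℝ) * x ^ (m + 1) + (q : ℝ) - 1 = 0
  have e : x ^ (m + 2) - (q : ℝ) * x ^ (m + 1) + (q : ℝ) - 1 = (x - 1) * g x := by
    have := hgeom x
    simp only [g]
    linear_combination ((q : ℝ) - 1) * this
  rw [e, hx0, mul_zero]

/-! ### Counting words without long runs of zeros -/

lemma replicate_infix_replicate_append_cons {m r b : ℕ} (hr : r ≤ m) (hb : b ≠ 0) (l : List ℕ) :
    List.replicate (m + 1) 0 <:+: List.replicate r 0 ++ b :: l ↔
      List.replicate (m + 1) 0 <:+: l := by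
  constructor
  · simp only [List.infix_iff_getElem?, List.length_replicate, List.getElem_replicate]
    rintro ⟨t, ht, h⟩
    simp only [List.length_append, List.length_replicate, List.length_cons] at ht
    -- A run starting at t ≤ r has length m + 1 > r - t, so it would cover the nonzero letter b.
    rcases le_or_gt t r with htr | htr
    · have := h (r - t) (by omega)
      rw [Nat.sub_add_cancel htr, List.getElem?_append_right (by simp)] at this
      simp [hb] at this
    · refine ⟨t - (r + 1), by omega, fun i hi => ?_⟩
      have := h i hi
      rw [List.getElem?_append_right (by simp; omega), List.length_replicate,
        show i + t - r = i + (t - (r + 1)) + 1 by omega, List.getElem?_cons_succ] at this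
      exact this
  · intro h
    exact h.trans ⟨List.replicate r 0 ++ [b], [], by simp⟩

/-- The number of words of length `n` that have no `m + 1` consecutive zeros when they are
preceded by `r` zeros. -/
def rllCount (q m n r : ℕ) : ℕ :=
  ∑ x : Fin n → Fin q,
    if List.replicate (m + 1) 0 <:+: List.replicate r 0 ++ List.ofFn (fun i => (x i : ℕ))
    then 0 else 1

lemma card_rll (q m n : ℕ) : (rll q m n).card = rllCount q m n 0 := by
  rw [rll, Finset.card_filter, rllCount]
  refine Finset.sum_congr rfl fun x _ => ?_
  rw [List.replicate_zero, List.nil_append, ite_not]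

lemma rllCount_zero {q m r : ℕ} (hr : r ≤ m) : rllCount q m 0 r = 1 := by
  have : ¬ List.replicate (m + 1) 0 <:+: List.replicate r 0 := fun h => by
    have := h.length_le
    simp at this
    omega
  simp [rllCount, this]

lemma rllCount_self (q m n : ℕ) : rllCount q m n (m + 1) = 0 := by
  refine Finset.sum_eq_zero fun x _ => if_pos ?_
  exact (List.prefix_append _ _).isInfix

/-- Split by the first letter: each of the q nonzero letters resets the run, and a zero prolongs it.
-/
lemma rllCount_succ {q m n r : ℕ} (hr : r ≤ m) :
    rllCount (q + 1) m (n + 1) r = q * rllCount (q + 1) m n 0 + rllCount (q + 1) m n (r + 1) := by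
  rw [rllCount, ← (Fin.consEquiv fun _ => Fin (q + 1)).sum_comp, Fintype.sum_prod_type,
    Fin.sum_univ_succ, add_comm]
  congr 1
  · rw [Finset.sum_congr rfl (g := fun _ => rllCount (q + 1) m n 0), Finset.sum_const,
      Finset.card_univ, Fintype.card_fin, smul_eq_mul]
    intro a _
    rw [rllCount]
    refine Finset.sum_congr rfl fun x _ => ?_
    simp only [Fin.consEquiv_apply, List.ofFn_succ, Fin.cons_zero, Fin.cons_succ,
      List.replicate_zero, List.nil_append]
    rw [if_congr (replicate_infix_replicate_append_cons hr (by simp) _) rfl rfl]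
  · rw [rllCount]
    refine Finset.sum_congr rfl fun x _ => ?_
    simp only [Fin.consEquiv_apply, List.ofFn_succ, Fin.cons_zero, Fin.cons_succ,
      List.replicate_succ' (n := r), List.append_assoc, List.singleton_append, Fin.val_zero]

/-- The vector v_r = 1 - λ^(-(m+1-r)) is an eigenvector, with eigenvalue λ, of the recursion in
`rllCount_succ`, and it vanishes at the forbidden state m + 1. For r ≤ m one has 1 - λ⁻¹ ≤ v_r ≤ 1,
so the initial counts 1 lie between v_r and v_r / (1 - λ⁻¹); the recursion preserves both bounds. -/
lemma rllCount_bounds {q m : ℕ} (hm : 1 ≤ m) (hq : 2 ≤ q) (n r : ℕ) (hr : r ≤ m + 1) :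
    (1 - (rllLambda m q)⁻¹ ^ (m + 1 - r)) * rllLambda m q ^ n ≤ rllCount q m n r ∧
      rllCount q m n r ≤ (1 - (rllLambda m q)⁻¹)⁻¹ * (1 - (rllLambda m q)⁻¹ ^ (m + 1 - r)) *
        rllLambda m q ^ n := by
  have h1 := one_lt_rllLambda hm hq
  have hroot : rllLambda m q ^ (m + 2) - (q : ℝ) * rllLambda m q ^ (m + 1) + (q : ℝ) - 1 = 0 :=
    (isGreatest_rllLambda m hq).1
  set c := rllLambda m q
  have hc0 : 0 < c := by linarith
  have hi1 : c⁻¹ < 1 := inv_lt_one_of_one_lt₀ h1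
  have hi0 : 0 < c⁻¹ := inv_pos.2 hc0
  set v : ℕ → ℝ := fun r => 1 - c⁻¹ ^ (m + 1 - r) with hv
  have hvm : v (m + 1) = 0 := by simp [hv]
  have hv_rec : ∀ r ≤ m, c * v r = (q - 1) * v 0 + v (r + 1) := by
    intro r hr
    obtain ⟨s, rfl⟩ := Nat.exists_eq_add_of_le hr
    have e1 : c * c⁻¹ = 1 := mul_inv_cancel₀ hc0.ne'
    have e2 : c ^ (r + s + 1) * c⁻¹ ^ (r + s + 1) = 1 := by rw [← mul_pow, e1, one_pow]
    simp only [hv, Nat.sub_zero, show r + s + 1 - r = s + 1 by omega,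
      show r + s + 1 - (r + 1) = s by omega]
    -- The root equation divided by c^(m+1).
    have e3 : c - 1 = (q - 1) * (1 - c⁻¹ ^ (r + s + 1)) := by
      linear_combination (c⁻¹ ^ (r + s + 1)) * hroot + ((q : ℝ) - c) * e2
    rw [← e3]
    linear_combination (-c⁻¹ ^ s) * e1
  change v r * c ^ n ≤ _ ∧ _ ≤ _ * v r * c ^ n
  obtain ⟨p, rfl⟩ : ∃ p, q = p + 1 := ⟨q - 1, by omega⟩
  induction n generalizing r with
  | zero =>
    rcases hr.eq_or_lt with rfl | hr
    · simp [hvm, rllCount_self]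
    · rw [rllCount_zero (by omega)]
      have h2 : c⁻¹ ^ (m + 1 - r) ≤ c⁻¹ := by
        simpa using pow_le_pow_of_le_one hi0.le hi1.le (show 1 ≤ m + 1 - r by omega)
      have h3 : 0 < c⁻¹ ^ (m + 1 - r) := by positivity
      constructor
      · simp only [hv]; push_cast; linarith
      · rw [pow_zero, mul_one, Nat.cast_one, inv_mul_eq_div, le_div_iff₀ (by linarith)]
        simp only [hv]; linarith
  | succ n ih =>
    rcases hr.eq_or_lt with rfl | hr
    · simp [hvm, rllCount_self]
    · have hr' : r ≤ m := by omega
      rw [rllCount_succ hr']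
      obtain ⟨a1, a2⟩ := ih 0 (by omega)
      obtain ⟨b1, b2⟩ := ih (r + 1) (by omega)
      have hp : (0 : ℝ) ≤ p := by positivity
      have hrec := hv_rec r hr'
      push_cast at hrec ⊢
      rw [add_sub_cancel_right] at hrec
      have e : v r * c ^ (n + 1) = p * (v 0 * c ^ n) + v (r + 1) * c ^ n := by
        linear_combination c ^ n * hrec
      constructor
      · rw [e]
        exact add_le_add (mul_le_mul_of_nonneg_left a1 hp) b1
      · rw [mul_assoc, e]
        calc _ ≤ _ := add_le_add (mul_le_mul_of_nonneg_left a2 hp) b2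
          _ = _ := by ring

lemma card_rll_bounds {q m : ℕ} (hm : 1 ≤ m) (hq : 2 ≤ q) :
    ∃ c C : ℝ, 0 < c ∧ 0 < C ∧ ∀ n, c * rllLambda m q ^ n ≤ (rll q m n).card ∧
      (rll q m n).card ≤ C * rllLambda m q ^ n := by
  have h1 := one_lt_rllLambda hm hq
  have hi1 : (rllLambda m q)⁻¹ < 1 := inv_lt_one_of_one_lt₀ h1
  have hi0 : 0 < (rllLambda m q)⁻¹ := inv_pos.2 (by linarith)
  have h2 : (rllLambda m q)⁻¹ ^ (m + 1) < 1 := pow_lt_one₀ hi0.le hi1 (by omega)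
  refine ⟨1 - (rllLambda m q)⁻¹ ^ (m + 1),
    (1 - (rllLambda m q)⁻¹)⁻¹ * (1 - (rllLambda m q)⁻¹ ^ (m + 1)), by linarith,
    mul_pos (inv_pos.2 (by linarith)) (by linarith), fun n => ?_⟩
  rw [card_rll]
  exact rllCount_bounds hm hq n 0 (by omega)

/-! ### Exponential growth rates -/

lemma tendsto_inv_mul_add_mul (a b : ℝ) :
    Tendsto (fun n : ℕ => 1 / (n : ℝ) * (a + n * b)) atTop (𝓝 b) := by
  have h : Tendsto (fun n : ℕ => a / (n : ℝ) + b) atTop (𝓝 (0 + b)) :=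
    (tendsto_const_div_atTop_nhds_zero_nat a).add tendsto_const_nhds
  rw [zero_add] at h
  refine h.congr' ?_
  filter_upwards [eventually_gt_atTop 0] with n hn
  have : (n : ℝ) ≠ 0 := by positivity
  field_simp

lemma rate_le_of_card_le {q n : ℕ} (hq : 2 ≤ q) {S : Finset (Fin n → Fin q)} {C t : ℝ}
    (hC : 0 < C) (ht : 0 < t) (hS : 0 < S.card) (h : S.card ≤ C * t ^ n) :
    rate S ≤ 1 / (n : ℝ) * (Real.logb q C + n * Real.logb q t) := by
  have hq' : (1 : ℝ) < q := by exact_mod_cast hq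
  rw [← Real.logb_pow, ← Real.logb_mul hC.ne' (by positivity)]
  refine mul_le_mul_of_nonneg_left ?_ (by positivity)
  exact (Real.logb_le_logb hq' (by exact_mod_cast hS) (by positivity)).2 h

lemma le_rate_of_le_card {q n : ℕ} (hq : 2 ≤ q) {S : Finset (Fin n → Fin q)} {c t : ℝ}
    (hc : 0 < c) (ht : 0 < t) (h : c * t ^ n ≤ S.card) :
    1 / (n : ℝ) * (Real.logb q c + n * Real.logb q t) ≤ rate S := by
  have hq' : (1 : ℝ) < q := by exact_mod_cast hq
  rw [← Real.logb_pow, ← Real.logb_mul hc.ne' (by positivity)]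
  refine mul_le_mul_of_nonneg_left ?_ (by positivity)
  have h0 : 0 < c * t ^ n := by positivity
  exact (Real.logb_le_logb hq' h0 (h0.trans_le h)).2 h

lemma tendsto_rate_rll {q m : ℕ} (hm : 1 ≤ m) (hq : 2 ≤ q) :
    Tendsto (fun n : ℕ => rate (rll q m n)) atTop (𝓝 (Real.logb q (rllLambda m q))) := by
  obtain ⟨c, C, hc, hC, h⟩ := card_rll_bounds hm hq
  have h1 : 0 < rllLambda m q := by linarith [one_lt_rllLambda hm hq]
  have hpos : ∀ n, 0 < (rll q m n).card := fun n => by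
    have : (0 : ℝ) < (rll q m n).card := lt_of_lt_of_le (by positivity) (h n).1
    exact_mod_cast this
  exact tendsto_of_tendsto_of_tendsto_of_le_of_le (tendsto_inv_mul_add_mul _ _)
    (tendsto_inv_mul_add_mul _ _) (fun n => le_rate_of_le_card hq hc h1 (h n).1)
    (fun n => rate_le_of_card_le hq hC h1 (hpos n) (h n).2)

/-! ### The number of nuclei and its upper bound -/

/-- The number of different nuclei of words of length `n`. -/
def numNuclei (q k ℓ n : ℕ) : ℕ :=
  (Finset.univ.image (nucleus k ℓ : (Fin n → Fin q) → List (Fin q → ℤ))).card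

lemma numNuclei_pos {q : ℕ} (hq : 0 < q) (k ℓ n : ℕ) : 0 < numNuclei q k ℓ n := by
  rw [numNuclei, Finset.card_pos]
  exact ⟨_, Finset.mem_image_of_mem _ (Finset.mem_univ fun _ => ⟨0, hq⟩)⟩

lemma numNuclei_le_pow (q k ℓ n : ℕ) : numNuclei q k ℓ n ≤ q ^ n :=
  Finset.card_image_le.trans (by simp)

/-- The `k`-step derivative of a word over the integers modulo `q`. -/
def stepDiff {q n : ℕ} [NeZero q] (k : ℕ) (x : Fin n → Fin q) (i : Fin n) : Fin q :=
  if (i : ℕ) < k then x i else x i - x ⟨i - k, by omega⟩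

/-- As a bijection of words, this derivative translates repetition at distance k into zeros. Its
first k entries are plain letters, whose zeros say nothing about repetition. -/
lemma stepDiff_injective {q n k : ℕ} [NeZero q] (hk : 0 < k) :
    Function.Injective (stepDiff k : (Fin n → Fin q) → Fin n → Fin q) := by
  intro x y h
  funext ⟨i, hi⟩
  induction i using Nat.strong_induction_on with
  | _ i ih =>
    have e := congrFun h ⟨i, hi⟩
    simp only [stepDiff] at e
    split_ifs at e with hik
    · exact e
    · rw [ih (i - k) (by omega)] at e
      simpa using e

lemma mem_rll_iff {q m n : ℕ} [NeZero q] (x : Fin n → Fin q) :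
    x ∈ rll q m n ↔ ¬ ∃ t, t + (m + 1) ≤ n ∧
      ∀ i (h : t + i < n), i < m + 1 → x ⟨t + i, h⟩ = 0 := by
  simp only [rll, Finset.mem_filter, Finset.mem_univ, true_and, List.infix_iff_getElem?,
    List.length_replicate, List.getElem_replicate, List.length_ofFn]
  refine not_congr (exists_congr fun t => ?_)
  rw [add_comm (m + 1) t]
  refine and_congr_right fun ht => forall_congr' fun i => ?_
  constructor
  · intro h hn hi
    have := h hi
    rw [add_comm i t, List.getElem?_eq_getElem (by simpa using hn)] at this
    simpa using this
  · intro h hi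
    have := h (by omega) hi
    rw [add_comm i t, List.getElem?_eq_getElem (by simp; omega)]
    simpa using this

/-- The k windows ending at c, …, c+k-1 meet only positions where the word repeats, so their
differences vanish. Deleting these k letters removes exactly this block of zeros from the
derivative. -/
lemma exists_nucleus_eq_of_run {q n k ℓ c : ℕ} (hℓ : 0 < ℓ) (x : Fin (n + k) → Fin q)
    (hcn : c ≤ n)
    (hx : ∀ i : ℤ, c - ℓ + 1 ≤ i → i < c + k → unitSeq x i = unitSeq x (i - k)) :
    ∃ x' : Fin n → Fin q, nucleus k ℓ x' = nucleus k ℓ x := by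
  let x' : Fin n → Fin q := fun i =>
    if (i : ℕ) < c then x ⟨i, by omega⟩ else x ⟨i + k, by omega⟩
  have h1 : ∀ i : ℤ, i < c → unitSeq x' i = unitSeq x i := by
    intro i hi
    rcases lt_or_ge i 0 with h0 | h0
    · rw [unitSeq_of_neg _ h0, unitSeq_of_neg _ h0]
    · rw [unitSeq_of_lt _ h0 (by omega), unitSeq_of_lt _ h0 (by push_cast; omega)]
      simp only [x']
      rw [if_pos (by omega)]
  -- A window difference reaches back k + ℓ - 1 positions. By the repetition, the shifted word
  -- agrees with x' this far to the left of c too.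
  have h2 : ∀ i : ℤ, c - ℓ + 1 - k ≤ i → unitSeq x' i = unitSeq x (i + k) := by
    intro i hi
    rcases lt_or_ge i c with h0 | h0
    · rw [h1 i h0, hx (i + k) (by omega) (by omega), add_sub_cancel_right]
    · rcases lt_or_ge i n with h3 | h3
      · rw [unitSeq_of_lt _ (by omega) h3, unitSeq_of_lt _ (by omega) (by push_cast; omega)]
        simp only [x']
        rw [if_neg (by omega)]
        congr 3
        omega
      · rw [unitSeq_of_le _ h3, unitSeq_of_le _ (by push_cast; omega)]
  refine ⟨x', ?_⟩
  obtain ⟨b, rfl⟩ := Nat.exists_eq_add_of_le hcn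
  rw [nucleus_eq, nucleus_eq, show c + b + ℓ - 1 = c + (b + (ℓ - 1)) by omega,
    show c + b + k + ℓ - 1 = c + (k + (b + (ℓ - 1))) by omega, List.range_add (n := c),
    List.range_add (n := c), List.range_add (n := k)]
  simp only [List.map_append, List.map_map]
  have e : List.map ((fun i : ℕ => windowDiff k ℓ (unitSeq x) i) ∘ fun x => c + x)
      (List.range k) = List.replicate k 0 := by
    rw [List.eq_replicate_iff]
    refine ⟨by simp, ?_⟩
    simp only [List.mem_map, List.mem_range, Function.comp]
    rintro _ ⟨j, hj, rfl⟩
    rw [windowDiff, windowSum, windowSum, ← Finset.sum_sub_distrib]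
    refine Finset.sum_eq_zero fun s hs => ?_
    rw [Finset.mem_range] at hs
    rw [hx _ (by push_cast; omega) (by push_cast; omega), sub_eq_zero]
    congr 1; ring
  rw [e, mu_append_replicate_append]
  congr 2
  · refine List.map_congr_left fun i hi => ?_
    rw [List.mem_range] at hi
    simp only [windowDiff, windowSum]
    congr 1 <;> exact Finset.sum_congr rfl fun s _ => h1 _ (by omega)
  · refine List.map_congr_left fun i hi => ?_
    simp only [windowDiff, windowSum, Function.comp]
    congr 1 <;> refine Finset.sum_congr rfl fun s hs => ?_ <;> rw [Finset.mem_range] at hs <;>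
      rw [h2 _ (by push_cast; omega)] <;> congr 1 <;> push_cast <;> ring

/-- The words of length `n + k` whose `k`-step derivative has no long run of zeros after its
first `k` entries. -/
def tailRLL (q k m n : ℕ) [NeZero q] : Finset (Fin (n + k) → Fin q) :=
  Finset.univ.filter fun x =>
    (fun i : Fin n => stepDiff k x ⟨k + i, by omega⟩) ∈ rll q m n

lemma card_tailRLL_le {q k : ℕ} [NeZero q] (hk : 0 < k) (m n : ℕ) :
    (tailRLL q k m n).card ≤ q ^ k * (rll q m n).card := by
  have : q ^ k * (rll q m n).card =
      ((Finset.univ : Finset (Fin k → Fin q)) ×ˢ rll q m n).card := by simp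
  rw [this]
  refine Finset.card_le_card_of_injOn (fun x => (fun i : Fin k => stepDiff k x ⟨i, by omega⟩,
    fun i : Fin n => stepDiff k x ⟨k + i, by omega⟩)) ?_ ?_
  · intro x hx
    simp only [tailRLL, Finset.coe_filter, Set.mem_ofPred_eq, Finset.mem_univ, true_and] at hx
    simpa using hx
  · intro x _ y _ h
    simp only [Prod.mk.injEq] at h
    refine stepDiff_injective hk ?_
    funext ⟨i, hi⟩
    rcases lt_or_ge i k with hik | hik
    · exact congrFun h.1 ⟨i, hik⟩
    · have := congrFun h.2 ⟨i - k, by omega⟩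
      simpa only [Nat.add_sub_cancel' hik] using this

lemma numNuclei_add_le {q k ℓ : ℕ} [NeZero q] (hk : 0 < k) (hℓ : 0 < ℓ) (n : ℕ) :
    numNuclei q k ℓ (n + k) ≤
      numNuclei q k ℓ n + q ^ k * (rll q (k + ℓ - 2) n).card := by
  have hsub : Finset.univ.image (nucleus k ℓ : (Fin (n + k) → Fin q) → List (Fin q → ℤ)) ⊆
      Finset.univ.image (nucleus k ℓ : (Fin n → Fin q) → List (Fin q → ℤ)) ∪
        (tailRLL q k (k + ℓ - 2) n).image (nucleus k ℓ) := by
    intro d hd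
    obtain ⟨x, -, rfl⟩ := Finset.mem_image.1 hd
    rw [Finset.mem_union]
    by_cases hx : x ∈ tailRLL q k (k + ℓ - 2) n
    · exact Or.inr (Finset.mem_image_of_mem _ hx)
    · left
      simp only [tailRLL, Finset.mem_filter, Finset.mem_univ, true_and, mem_rll_iff,
        not_not] at hx
      obtain ⟨t, ht, h⟩ := hx
      -- The run of zeros occupies positions t + k, …, t + 2k + ℓ - 2, so its start t + k equals c -
      -- ℓ + 1 for the cut c = t + k + ℓ - 1.
      have hrun : ∀ i : ℤ, (t + k + ℓ - 1 : ℕ) - ℓ + 1 ≤ i → i < (t + k + ℓ - 1 : ℕ) + k →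
          unitSeq x i = unitSeq x (i - k) := by
        intro i hi1 hi2
        have h0 : 0 ≤ i - t - k := by omega
        obtain ⟨j, hj⟩ := Int.eq_ofNat_of_zero_le h0
        have := h j (by omega) (by omega)
        simp only [stepDiff] at this
        rw [if_neg (by omega), sub_eq_zero] at this
        rw [unitSeq_of_lt x (by omega) (by push_cast; omega),
          unitSeq_of_lt x (by omega) (by push_cast; omega)]
        congr 1
        convert this using 3 <;> omega
      obtain ⟨x', hx'⟩ := exists_nucleus_eq_of_run (by omega) x (by omega) hrun
      exact Finset.mem_image.2 ⟨x', Finset.mem_univ _, hx'⟩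
  calc _ ≤ _ := Finset.card_le_card hsub
    _ ≤ _ := Finset.card_union_le _ _
    _ ≤ _ := Nat.add_le_add_left (Finset.card_image_le.trans (card_tailRLL_le hk _ n)) _

lemma exists_numNuclei_le {q k ℓ : ℕ} (hq : 2 ≤ q) (hk : 0 < k) (hℓ : 2 ≤ ℓ) :
    ∃ C : ℝ, 0 < C ∧ ∀ n, numNuclei q k ℓ n ≤ C * rllLambda (k + ℓ - 2) q ^ n := by
  have : NeZero q := ⟨by omega⟩
  have hm : 1 ≤ k + ℓ - 2 := by omega
  obtain ⟨_, A, _, hA, hN⟩ := card_rll_bounds hm hq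
  have h1 := one_lt_rllLambda hm hq
  set c := rllLambda (k + ℓ - 2) q
  have hck : 1 < c ^ k := one_lt_pow₀ h1 hk.ne'
  have hq0 : (0 : ℝ) < q := by positivity
  -- B solves q^k A = B (c^k - 1), so B c^n absorbs the increments of the recursion; the summand q^k
  -- covers the lengths n < k.
  set B : ℝ := q ^ k * A / (c ^ k - 1) with hB
  have hB0 : 0 < B := by
    have : 0 < c ^ k - 1 := by linarith
    positivity
  refine ⟨q ^ k + B, by positivity, fun n => ?_⟩
  induction n using Nat.strong_induction_on with
  | _ n ih =>
    rcases lt_or_ge n k with hnk | hnk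
    · have h2 : ((numNuclei q k ℓ n : ℕ) : ℝ) ≤ q ^ k := by
        exact_mod_cast (numNuclei_le_pow q k ℓ n).trans
          (Nat.pow_le_pow_right (by omega) hnk.le)
      have h3 : 1 ≤ c ^ n := one_le_pow₀ h1.le
      have h4 : (0 : ℝ) < q ^ k := by positivity
      nlinarith
    · obtain ⟨p, rfl⟩ := Nat.exists_eq_add_of_le' hnk
      have h2 := ih p (by omega)
      have h3 : ((numNuclei q k ℓ (p + k) : ℕ) : ℝ) ≤
          numNuclei q k ℓ p + q ^ k * (rll q (k + ℓ - 2) p).card := by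
        exact_mod_cast numNuclei_add_le hk (by omega) p
      have h4 : (q : ℝ) ^ k * (rll q (k + ℓ - 2) p).card ≤ q ^ k * (A * c ^ p) :=
        mul_le_mul_of_nonneg_left (hN p).2 (by positivity)
      have h5 : (q : ℝ) ^ k * A = B * (c ^ k - 1) := by
        rw [hB, div_mul_cancel₀]
        linarith
      have h6 : (0 : ℝ) ≤ q ^ k * c ^ p * (c ^ k - 1) := by
        have : 0 < c ^ k - 1 := by linarith
        positivity
      calc _ ≤ (q ^ k + B) * c ^ p + q ^ k * (A * c ^ p) := by linarith
        _ = (q ^ k + B) * c ^ p + B * (c ^ k - 1) * c ^ p := by rw [← h5]; ring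
        _ ≤ (q ^ k + B) * c ^ p + B * (c ^ k - 1) * c ^ p + q ^ k * c ^ p * (c ^ k - 1) := by
          linarith
        _ = _ := by rw [pow_add]; ring

/-! ### Existence of the limit -/

lemma windowDiff_congr {G : Type*} [AddCommGroup G] {k ℓ : ℕ} {X Y : ℤ → G} {i j : ℤ}
    (h : ∀ s : ℕ, s < k + ℓ → X (i - s) = Y (j - s)) :
    windowDiff k ℓ X i = windowDiff k ℓ Y j := by
  simp only [windowDiff, windowSum]
  congr 1 <;> refine Finset.sum_congr rfl fun s hs => ?_ <;> rw [Finset.mem_range] at hs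
  · exact h s (by omega)
  · have := h (k + s) (by omega)
    push_cast at this
    rwa [← sub_sub, ← sub_sub] at this

lemma unitSeq_append_of_lt {q n m : ℕ} (x : Fin n → Fin q) (y : Fin m → Fin q) {i : ℤ}
    (h : i < n) : unitSeq (Fin.append x y) i = unitSeq x i := by
  rcases lt_or_ge i 0 with h0 | h0
  · rw [unitSeq_of_neg _ h0, unitSeq_of_neg _ h0]
  · rw [unitSeq_of_lt _ h0 (by push_cast; omega), unitSeq_of_lt _ h0 h]
    congr 1
    exact Fin.append_left x y ⟨i.toNat, by omega⟩

lemma unitSeq_append_of_le {q n m : ℕ} (x : Fin n → Fin q) (y : Fin m → Fin q) {i : ℤ}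
    (h : n ≤ i) : unitSeq (Fin.append x y) i = unitSeq y (i - n) := by
  rcases lt_or_ge i (n + m) with h0 | h0
  · rw [unitSeq_of_lt _ (by omega) (by push_cast; omega), unitSeq_of_lt _ (by omega) (by omega)]
    congr 1
    rw [← Fin.append_right x y ⟨(i - n).toNat, by omega⟩]
    congr 1
    ext
    simp only [Fin.val_natAdd]
    omega
  · rw [unitSeq_of_le _ (by push_cast; omega), unitSeq_of_le _ (by omega)]

/-- The nucleus of a concatenation is determined by the nuclei of both parts together with the
letters next to the joint. -/
lemma nucleus_append_eq {q n m k ℓ : ℕ} (hk : 0 < k) (hℓ : 0 < ℓ) {x x' : Fin n → Fin q}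
    {y y' : Fin m → Fin q} (hx : nucleus k ℓ x = nucleus k ℓ x')
    (hy : nucleus k ℓ y = nucleus k ℓ y')
    (hxs : ∀ i : ℤ, n - (k + ℓ) ≤ i → unitSeq x i = unitSeq x' i)
    (hys : ∀ i : ℤ, i < k + ℓ → unitSeq y i = unitSeq y' i) :
    nucleus k ℓ (Fin.append x y) = nucleus k ℓ (Fin.append x' y') := by
  rw [nucleus_eq, nucleus_eq] at hx hy ⊢
  rw [show n + ℓ - 1 = n + (ℓ - 1) by omega, List.range_add] at hx
  rw [show n + m + ℓ - 1 = n + (m + ℓ - 1) by omega, List.range_add]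
  simp only [List.map_append, List.map_map] at hx ⊢
  have e1 : ∀ (x : Fin n → Fin q) (y : Fin m → Fin q),
      (List.range n).map (fun i : ℕ => windowDiff k ℓ (unitSeq (Fin.append x y)) i) =
        (List.range n).map fun i : ℕ => windowDiff k ℓ (unitSeq x) i := fun x y =>
    List.map_congr_left fun i hi => windowDiff_congr fun s _ =>
      unitSeq_append_of_lt x y (by rw [List.mem_range] at hi; omega)
  rw [e1, e1]
  -- The last ℓ - 1 entries depend only on letters near the end, which agree, so they can be
  -- cancelled.
  have hA := mu_append_right_cancel hk _ <| hx.trans <| congrArg (mu k) <|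
    congrArg (_ ++ ·) <| List.map_congr_left (g :=
      (fun i : ℕ => windowDiff k ℓ (unitSeq x) i) ∘ fun x => n + x) fun i hi =>
        windowDiff_congr fun s hs => (hxs _ (by push_cast; omega)).symm
  refine mu_append_congr₂ hA ?_
  -- beyond the joint, the windows no longer meet the first part
  have e2 : ∀ (x : Fin n → Fin q) (y : Fin m → Fin q) (i : ℕ), k + ℓ ≤ i →
      windowDiff k ℓ (unitSeq (Fin.append x y)) (n + i : ℕ) = windowDiff k ℓ (unitSeq y) i :=
    fun x y i hi => windowDiff_congr fun s hs => by
      rw [unitSeq_append_of_le x y (by push_cast; omega)]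
      congr 1; push_cast; ring
  have e3 : ∀ i : ℕ, i < k + ℓ → windowDiff k ℓ (unitSeq (Fin.append x y)) (n + i : ℕ) =
      windowDiff k ℓ (unitSeq (Fin.append x' y')) (n + i : ℕ) :=
    fun i hi => windowDiff_congr fun s hs => by
      rcases lt_or_ge (((n + i : ℕ) : ℤ) - s) n with h | h
      · rw [unitSeq_append_of_lt _ _ h, unitSeq_append_of_lt _ _ h]
        exact hxs _ (by push_cast; omega)
      · rw [unitSeq_append_of_le _ _ h, unitSeq_append_of_le _ _ h]
        exact hys _ (by push_cast; omega)
  rcases le_or_gt (m + ℓ - 1) (k + ℓ) with hm | hm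
  · refine congrArg (mu k) (List.map_congr_left fun i hi => e3 i ?_)
    rw [List.mem_range] at hi
    omega
  · obtain ⟨b, hb⟩ := Nat.exists_eq_add_of_le hm.le
    rw [hb, List.range_add, List.map_append, List.map_append] at hy ⊢
    have e4 : (List.range (k + ℓ)).map (fun i : ℕ => windowDiff k ℓ (unitSeq y) i) =
        (List.range (k + ℓ)).map fun i : ℕ => windowDiff k ℓ (unitSeq y') i :=
      List.map_congr_left fun i hi => windowDiff_congr fun s _ =>
        hys _ (by rw [List.mem_range] at hi; omega)
    rw [e4] at hy
    have hB := mu_append_left_cancel hk _ hy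
    refine mu_append_congr₂ (congrArg (mu k) (List.map_congr_left fun i hi => e3 i ?_)) ?_
    · rwa [List.mem_range] at hi
    · simp only [List.map_map] at hB ⊢
      convert hB using 2 <;> exact List.map_congr_left fun i _ => e2 _ _ _ (Nat.le_add_right _ i)

lemma numNuclei_append_le {q k ℓ : ℕ} (hq : 0 < q) (hk : 0 < k) (hℓ : 0 < ℓ) (n m : ℕ) :
    numNuclei q k ℓ (n + m) ≤
      (q ^ (k + ℓ) * q ^ (k + ℓ)) * (numNuclei q k ℓ n * numNuclei q k ℓ m) := by
  classical
  let a : Fin q := ⟨0, hq⟩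
  -- the letters next to the joint
  let last : (Fin n → Fin q) → Fin (k + ℓ) → Fin q := fun x j =>
    if h : (j : ℕ) < n then x ⟨n - 1 - j, by omega⟩ else a
  let first : (Fin m → Fin q) → Fin (k + ℓ) → Fin q := fun y j =>
    if h : (j : ℕ) < m then y ⟨j, h⟩ else a
  let Φ : (Fin n → Fin q) × (Fin m → Fin q) →
      ((Fin (k + ℓ) → Fin q) × (Fin (k + ℓ) → Fin q)) ×
        (List (Fin q → ℤ) × List (Fin q → ℤ)) := fun p =>
    ((last p.1, first p.2), (nucleus k ℓ p.1, nucleus k ℓ p.2))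
  let Ψ : (Fin n → Fin q) × (Fin m → Fin q) → List (Fin q → ℤ) := fun p =>
    nucleus k ℓ (Fin.append p.1 p.2)
  have hΦΨ : ∀ p p', Φ p = Φ p' → Ψ p = Ψ p' := by
    rintro ⟨x, y⟩ ⟨x', y'⟩ h
    simp only [Φ, Prod.mk.injEq] at h
    obtain ⟨⟨h1, h2⟩, h3, h4⟩ := h
    refine nucleus_append_eq hk hℓ h3 h4 (fun i hi => ?_) (fun i hi => ?_)
    · rcases lt_or_ge i 0 with h0 | h0
      · rw [unitSeq_of_neg _ h0, unitSeq_of_neg _ h0]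
      rcases lt_or_ge i n with hn | hn
      · have := congrFun h1 ⟨n - 1 - i.toNat, by omega⟩
        simp only [last] at this
        rw [dif_pos (by omega), dif_pos (by omega)] at this
        rw [unitSeq_of_lt _ h0 hn, unitSeq_of_lt _ h0 hn]
        congr 1
        convert this using 3 <;> omega
      · rw [unitSeq_of_le _ hn, unitSeq_of_le _ hn]
    · rcases lt_or_ge i 0 with h0 | h0
      · rw [unitSeq_of_neg _ h0, unitSeq_of_neg _ h0]
      rcases lt_or_ge i m with hm | hm
      · have := congrFun h2 ⟨i.toNat, by omega⟩
        simp only [first] at this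
        rw [dif_pos (by omega), dif_pos (by omega)] at this
        rw [unitSeq_of_lt _ h0 hm, unitSeq_of_lt _ h0 hm]
        exact congrArg (Pi.single · 1) this
      · rw [unitSeq_of_le _ hm, unitSeq_of_le _ hm]
  have hcard : (Finset.univ.image Ψ).card ≤ (Finset.univ.image Φ).card := by
    have hs : ∀ d ∈ Finset.univ.image Ψ, ∃ p, Ψ p = d := fun d hd => by simpa using hd
    have : Nonempty ((Fin n → Fin q) × (Fin m → Fin q)) := ⟨(fun _ => a, fun _ => a)⟩
    -- Ψ factors through Φ, so Φ is injective on a section of Ψ.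
    choose! g hg using hs
    refine Finset.card_le_card_of_injOn (fun d => Φ (g d))
      (fun d _ => by simp) fun d hd d' hd' h => ?_
    rw [← hg d hd, ← hg d' hd', hΦΨ _ _ h]
  have h1 : Finset.univ.image (nucleus k ℓ : (Fin (n + m) → Fin q) → List (Fin q → ℤ)) ⊆
      Finset.univ.image Ψ := by
    intro d hd
    obtain ⟨x, -, rfl⟩ := Finset.mem_image.1 hd
    refine Finset.mem_image.2 ⟨(fun i => x (Fin.castAdd m i), fun i => x (Fin.natAdd n i)),
      Finset.mem_univ _, ?_⟩
    simp only [Ψ]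
    rw [Fin.append_castAdd_natAdd]
  have h2 : Finset.univ.image Φ ⊆ (Finset.univ ×ˢ Finset.univ) ×ˢ
      (Finset.univ.image (nucleus k ℓ : (Fin n → Fin q) → List (Fin q → ℤ)) ×ˢ
        Finset.univ.image (nucleus k ℓ : (Fin m → Fin q) → List (Fin q → ℤ))) := by
    intro d hd
    obtain ⟨p, -, rfl⟩ := Finset.mem_image.1 hd
    simp [Φ]
  calc numNuclei q k ℓ (n + m) ≤ _ := Finset.card_le_card h1
    _ ≤ _ := hcard
    _ ≤ _ := Finset.card_le_card h2
    _ = _ := by simp [Finset.card_product, numNuclei]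

lemma exists_tendsto_log_numNuclei {q k ℓ : ℕ} (hq : 0 < q) (hk : 0 < k) (hℓ : 0 < ℓ) :
    ∃ L : ℝ, Tendsto (fun n : ℕ => Real.log (numNuclei q k ℓ n) / n) atTop (𝓝 L) := by
  set K : ℝ := q ^ (k + ℓ) * q ^ (k + ℓ) with hK
  have hq1 : (1 : ℝ) ≤ q := by exact_mod_cast hq
  have hK1 : 1 ≤ K := one_le_mul_of_one_le_of_one_le (one_le_pow₀ hq1) (one_le_pow₀ hq1)
  have hM1 : ∀ n, (1 : ℝ) ≤ numNuclei q k ℓ n := fun n => by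
    exact_mod_cast numNuclei_pos hq k ℓ n
  have hK0 : K ≠ 0 := by linarith
  have hM0 : ∀ n, (numNuclei q k ℓ n : ℝ) ≠ 0 := fun n => by linarith [hM1 n]
  -- Adding log K absorbs the constant of `numNuclei_append_le`; its share log K / n tends to 0.
  let u : ℕ → ℝ := fun n => Real.log K + Real.log (numNuclei q k ℓ n)
  have hu : Subadditive u := fun n m => by
    have h : (numNuclei q k ℓ (n + m) : ℝ) ≤ K * (numNuclei q k ℓ n * numNuclei q k ℓ m) := by
      rw [hK]
      exact_mod_cast numNuclei_append_le hq hk hℓ n m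
    have h' := Real.log_le_log (by linarith [hM1 (n + m)]) h
    rw [Real.log_mul hK0 (mul_ne_zero (hM0 n) (hM0 m)), Real.log_mul (hM0 n) (hM0 m)] at h'
    simp only [u]
    linarith
  have hb : BddBelow (Set.range fun n => u n / n) := by
    refine ⟨0, ?_⟩
    rintro _ ⟨n, rfl⟩
    have := Real.log_nonneg hK1
    have := Real.log_nonneg (hM1 n)
    positivity
  refine ⟨hu.lim, ?_⟩
  have h := (hu.tendsto_lim hb).sub (tendsto_const_div_atTop_nhds_zero_nat (Real.log K))
  rw [sub_zero] at h
  refine h.congr fun n => ?_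
  simp only [u]
  ring

/-! ### The lower bound when `ℓ` divides `k` -/

lemma unitSeq_le_one {q n : ℕ} (x : Fin n → Fin q) (i : ℤ) (a : Fin q) : unitSeq x i a ≤ 1 := by
  unfold unitSeq
  split_ifs
  · by_cases h : a = x ⟨i.toNat, by omega⟩
    · subst h; simp
    · simp [h]
  · simp

lemma unitSeq_ne_zero {q n : ℕ} (x : Fin n → Fin q) {i : ℤ} (h : 0 ≤ i) (h' : i < n) :
    unitSeq x i ≠ 0 := by
  rw [unitSeq_of_lt x h h']
  exact Pi.single_ne_zero_iff.2 one_ne_zero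

lemma windowDiff_eq_sum {G : Type*} [AddCommGroup G] (k ℓ : ℕ) (X : ℤ → G) (i : ℤ) :
    windowDiff k ℓ X i = ∑ j ∈ Finset.range ℓ, (X (i - j) - X (i - j - k)) := by
  rw [windowDiff, windowSum, windowSum, ← Finset.sum_sub_distrib]
  refine Finset.sum_congr rfl fun j _ => ?_
  congr 2; ring

/-- Consecutive window sums differ by the entries at both ends. -/
lemma sum_window_sub {G : Type*} [AddCommGroup G] (ℓ : ℕ) (e : ℤ → G) (i : ℤ) :
    ∑ j ∈ Finset.range ℓ, e (i - j) - ∑ j ∈ Finset.range ℓ, e (i - 1 - j) = e i - e (i - ℓ) := by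
  rw [← Finset.sum_sub_distrib]
  have := Finset.sum_range_sub' (fun j : ℕ => e (i - j)) ℓ
  rw [Nat.cast_zero, sub_zero] at this
  rw [← this]
  refine Finset.sum_congr rfl fun j _ => ?_
  congr 2; push_cast; ring

/-- If `ℓ ∣ k`, then `k` consecutive vanishing window differences force the word to repeat with
distance `k` on all windows involved. -/
lemma unitSeq_sub_eq_zero_of_windowDiff {q n k ℓ : ℕ} (hk : 0 < k) (hℓ : 0 < ℓ) (hdvd : ℓ ∣ k)
    (x : Fin n → Fin q) {t : ℤ}
    (h : ∀ i, t ≤ i → i < t + k → windowDiff k ℓ (unitSeq x) i = 0) {i : ℤ}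
    (h1 : t - ℓ < i) (h2 : i < t + k) : unitSeq x i - unitSeq x (i - k) = 0 := by
  set e : ℤ → Fin q → ℤ := fun i => unitSeq x i - unitSeq x (i - k) with he
  have hsum : ∀ i, t ≤ i → i < t + k → ∑ j ∈ Finset.range ℓ, e (i - j) = 0 := fun i h1 h2 => by
    rw [← h i h1 h2, windowDiff_eq_sum]
  have hper : ∀ i, t < i → i < t + k → e i = e (i - ℓ) := fun i h1 h2 => by
    have := sum_window_sub ℓ e i
    rw [hsum i (by omega) h2, hsum (i - 1) (by omega) (by omega), sub_self] at this
    exact (sub_eq_zero.1 this.symm)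
  have hmul : ∀ s : ℕ, ∀ i, t - ℓ < i → i + ℓ * s < t + k → e (i + ℓ * s) = e i := by
    intro s
    induction s with
    | zero => simp
    | succ s ih =>
      intro i h1 h2
      push_cast at h2 ⊢
      have hs : (0 : ℤ) ≤ ℓ * s := by positivity
      rw [mul_add, mul_one, ← add_assoc] at h2 ⊢
      rw [hper _ (by omega) h2, add_sub_cancel_right, ih i h1 (by omega)]
  have hzero : ∀ i, t - ℓ < i → i < t → e i = 0 := by
    intro i h1 h2
    obtain ⟨d, hd⟩ := hdvd
    have hkd : (ℓ : ℤ) * d = k := by rw [hd]; push_cast; rfl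
    have h3 := hmul d i h1 (by omega)
    rw [hkd] at h3
    simp only [he, add_sub_cancel_right] at h3 ⊢
    funext a
    have h4 := congrFun h3 a
    simp only [Pi.sub_apply, Pi.zero_apply] at h4 ⊢
    -- The entries at i - k, i, i + k form an arithmetic progression in {0, 1}, hence are constant.
    have := unitSeq_nonneg x i a
    have := unitSeq_nonneg x (i - k) a
    have := unitSeq_nonneg x (i + k) a
    have := unitSeq_le_one x i a
    have := unitSeq_le_one x (i - k) a
    have := unitSeq_le_one x (i + k) a
    omega
  have hzero' : ∀ i, t - ℓ < i → i ≤ t → e i = 0 := by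
    intro i h1 h2
    rcases h2.lt_or_eq with h2 | rfl
    · exact hzero i h1 h2
    -- In the window ending at t all other summands are already known to vanish.
    · have := hsum i le_rfl (by omega)
      obtain ⟨p, rfl⟩ : ∃ p, ℓ = p + 1 := ⟨ℓ - 1, by omega⟩
      rw [Finset.sum_range_succ', Finset.sum_eq_zero fun j hj => ?_] at this
      · simpa using this
      · rw [Finset.mem_range] at hj
        exact hzero _ (by push_cast; omega) (by push_cast; omega)
  obtain ⟨s, hs⟩ := Int.eq_ofNat_of_zero_le (show 0 ≤ i - (t - ℓ + 1) by omega)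
  induction s using Nat.strong_induction_on generalizing i with
  | _ s ih =>
    rcases le_or_gt i t with hit | hit
    · exact hzero' i h1 hit
    · exact (hper i hit h2).trans
        (ih (s - ℓ) (by omega) (i := i - ℓ) (by omega) (by omega) (by omega))

/-- A run of k zeros in the derivative would force repetition at k+ℓ-1 consecutive positions. It
cannot stick out of the word, where a letter would be compared with zero padding, so it is a
forbidden run in the step derivative. -/
lemma nucleus_eq_derivative {q n k ℓ : ℕ} [NeZero q] (hk : 0 < k) (hℓ : 0 < ℓ) (hdvd : ℓ ∣ k)
    {x : Fin n → Fin q} (hx : stepDiff k x ∈ rll q (k + ℓ - 2) n) :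
    nucleus k ℓ x = derivative k (readVector ℓ (List.ofFn x)) := by
  rw [nucleus]
  refine mu_eq_of_not_infix fun hinf => ?_
  have hle : ℓ ≤ k := Nat.le_of_dvd hk hdvd
  rw [derivative_readVector, List.infix_iff_getElem?] at hinf
  simp only [List.length_replicate, List.length_map, List.length_range,
    List.getElem_replicate] at hinf
  obtain ⟨t, ht, hinf⟩ := hinf
  have hW : ∀ i : ℤ, (t : ℤ) ≤ i → i < t + k → windowDiff k ℓ (unitSeq x) i = 0 := by
    intro i h1 h2
    obtain ⟨s, hs⟩ := Int.eq_ofNat_of_zero_le (show 0 ≤ i - t by omega)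
    have := hinf s (by omega)
    rw [List.getElem?_eq_getElem (by simp; omega)] at this
    simp only [List.getElem_map, List.getElem_range, Option.some.injEq] at this
    rw [← this]
    congr 1; push_cast; omega
  have hE : ∀ i : ℤ, (t : ℤ) - ℓ < i → i < t + k → unitSeq x i = unitSeq x (i - k) :=
    fun i h1 h2 => sub_eq_zero.1 (unitSeq_sub_eq_zero_of_windowDiff hk hℓ hdvd x hW h1 h2)
  have htn : t < n := by omega
  have hkt : k ≤ t := by
    by_contra! h
    have := hE t (by omega) (by omega)
    rw [unitSeq_of_neg x (i := (t : ℤ) - k) (by omega)] at this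
    exact unitSeq_ne_zero x (by omega) (by omega) this
  -- Otherwise the repetition would include position k - 1, whose partner -1 lies before the word.
  have hkt' : k + ℓ ≤ t + 1 := by
    by_contra! h
    have := hE (k - 1) (by omega) (by omega)
    rw [unitSeq_of_neg x (i := (k : ℤ) - 1 - k) (by omega)] at this
    exact unitSeq_ne_zero x (by omega) (by omega) this
  have htk : t + k ≤ n := by
    by_contra! h
    have := hE n (by omega) (by omega)
    rw [unitSeq_of_le x le_rfl] at this
    exact unitSeq_ne_zero x (by omega) (by omega) this.symm
  refine (mem_rll_iff _).1 hx ⟨t + 1 - ℓ, by omega, fun i hi hi' => ?_⟩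
  rw [stepDiff, if_neg (by simp only; omega), sub_eq_zero]
  have := hE (t + 1 - ℓ + i : ℕ) (by omega) (by omega)
  rw [unitSeq_of_lt x (by omega) (by omega), unitSeq_of_lt x (by omega) (by omega)] at this
  have := single_one_injective this
  convert this using 3
  · omega
  · simp only
    omega

lemma readVector_ofFn_injective {q n ℓ : ℕ} (hℓ : 0 < ℓ) :
    Function.Injective fun x : Fin n → Fin q => readVector ℓ (List.ofFn x) := by
  intro x y h
  simp only [readVector_eq] at h
  have hw : ∀ i : ℕ, i < n → windowSum ℓ (unitSeq x) i = windowSum ℓ (unitSeq y) i :=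
    fun i hi => List.map_inj_left.1 h i (by rw [List.mem_range]; omega)
  have hX : ∀ i : ℕ, i < n → unitSeq x i = unitSeq y i := by
    intro i
    induction i using Nat.strong_induction_on with
    | _ i ih =>
      intro hi
      have := hw i hi
      obtain ⟨p, rfl⟩ : ∃ p, ℓ = p + 1 := ⟨ℓ - 1, by omega⟩
      rw [windowSum, windowSum, Finset.sum_range_succ', Finset.sum_range_succ',
        Finset.sum_congr rfl (g := fun j : ℕ => unitSeq y ((i : ℤ) - (j + 1 : ℕ)))] at this
      · simpa using this
      · intro j _
        rcases lt_or_ge i (j + 1) with hj | hj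
        · rw [unitSeq_of_neg _ (by omega), unitSeq_of_neg _ (by omega)]
        · rw [← Nat.cast_sub hj]
          exact ih _ (by omega) (by omega)
  funext i
  have := hX i i.2
  rw [unitSeq_natCast, unitSeq_natCast] at this
  exact single_one_injective this

lemma card_rll_le_numNuclei {q k ℓ : ℕ} [NeZero q] (hk : 0 < k) (hℓ : 0 < ℓ) (hdvd : ℓ ∣ k)
    (n : ℕ) : (rll q (k + ℓ - 2) n).card ≤ numNuclei q k ℓ n := by
  have hsurj : Function.Surjective (stepDiff k : (Fin n → Fin q) → Fin n → Fin q) :=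
    Finite.injective_iff_surjective.1 (stepDiff_injective hk)
  choose g hg using hsurj
  refine Finset.card_le_card_of_injOn (fun w => nucleus k ℓ (g w)) (fun w _ => by simp) ?_
  intro w hw w' hw' h
  simp only at h
  rw [nucleus_eq_derivative hk hℓ hdvd ((hg w).symm ▸ hw),
    nucleus_eq_derivative hk hℓ hdvd ((hg w').symm ▸ hw')] at h
  rw [← hg w, ← hg w', readVector_ofFn_injective hℓ (derivative_injective hk h)]

end Nanopore

/-! ### Optimality and rates of nucleus codes -/

theorem mainTheorem1 (q k ℓ : ℕ) (hq : 2 ≤ q) (hk : 2 ≤ k) (hℓ : 2 ≤ ℓ)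
    (C : (n : ℕ) → Finset (Fin n → Fin q))
    (hC : ∀ n : ℕ, Nanopore.IsNucleusCode k ℓ (C n)) :
    (∀ n : ℕ, Nanopore.IsOptimal k ℓ (C n)) ∧
    IsGreatest (Nanopore.rllRoots (k + ℓ - 2) q) (Nanopore.rllLambda (k + ℓ - 2) q) ∧
    Tendsto (fun n : ℕ => Nanopore.rate (Nanopore.rll q (k + ℓ - 2) n)) atTop
      (𝓝 (Real.logb q (Nanopore.rllLambda (k + ℓ - 2) q))) ∧
    (∃ L : ℝ, Tendsto (fun n : ℕ => Nanopore.rate (C n)) atTop (𝓝 L) ∧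
      L ≤ Real.logb q (Nanopore.rllLambda (k + ℓ - 2) q)) ∧
    (ℓ ∣ k → Tendsto (fun n : ℕ => Nanopore.rate (C n)) atTop
      (𝓝 (Real.logb q (Nanopore.rllLambda (k + ℓ - 2) q)))) := by
  have : NeZero q := ⟨by omega⟩
  have hm : 1 ≤ k + ℓ - 2 := by omega
  have hlam : 0 < Nanopore.rllLambda (k + ℓ - 2) q := by
    linarith [Nanopore.one_lt_rllLambda hm hq]
  have hcard : ∀ n, (C n).card = Nanopore.numNuclei q k ℓ n := fun n => (hC n).card_eq
  obtain ⟨L, hL⟩ := Nanopore.exists_tendsto_log_numNuclei (q := q) (k := k) (ℓ := ℓ)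
    (by omega) (by omega) (by omega)
  have hrate : Tendsto (fun n : ℕ => Nanopore.rate (C n)) atTop (𝓝 (L / Real.log q)) := by
    refine (hL.div_const _).congr fun n => ?_
    rw [Nanopore.rate, hcard, Real.logb]
    ring
  obtain ⟨A, hA, hAn⟩ := Nanopore.exists_numNuclei_le hq (by omega : 0 < k) hℓ
  have hle : L / Real.log q ≤ Real.logb q (Nanopore.rllLambda (k + ℓ - 2) q) :=
    le_of_tendsto_of_tendsto' hrate (Nanopore.tendsto_inv_mul_add_mul _ _) fun n =>
      Nanopore.rate_le_of_card_le hq hA hlam (hcard n ▸ Nanopore.numNuclei_pos (by omega) k ℓ n)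
        (hcard n ▸ hAn n)
  refine ⟨fun n => (hC n).isOptimal (by omega) (by omega),
    Nanopore.isGreatest_rllLambda _ hq, Nanopore.tendsto_rate_rll hm hq,
    ⟨_, hrate, hle⟩, fun hdvd => ?_⟩
  obtain ⟨c, _, hc, _, hcn⟩ := Nanopore.card_rll_bounds hm hq
  have hge : Real.logb q (Nanopore.rllLambda (k + ℓ - 2) q) ≤ L / Real.log q :=
    le_of_tendsto_of_tendsto' (Nanopore.tendsto_inv_mul_add_mul _ _) hrate fun n =>
      Nanopore.le_rate_of_le_card hq hc hlam <| (hcn n).1.trans <| by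
        rw [hcard]
        exact_mod_cast Nanopore.card_rll_le_numNuclei (by omega) (by omega) hdvd n
  rwa [le_antisymm hge hle]
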